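/- Let $0\le\mu<\infty$ and $0<p\le q<\infty$. A weight on $\mathbb{R}$ is a measurable function $w:\mathbb{R}\to[0,\infty)$ with $w>0$ almost everywhere. For a measurable function $f:\mathbb{R}\to[-\infty,\infty]$ let $$m_\mu^+(f)(x)=\inf_{h>0}\frac{1}{h^{1+\mu}}\int_x^{x+h}|f(t)|\,dt\in[0,\infty]$$ be the fractional one-sided minimal function of order $\mu$. Let $(U,V)$ be a pair of weights on $\mathbb{R}$ and put $\omega=V^{1/(p+1)}$; for an interval $I$ let $\omega/\chi_I$ denote the function equal to $\omega$ on $I$ and to $+\infty$ outside $I$. All integrals take values in $[0,\infty]$, with $c/0=\infty$ for $c>0$ and $c/\infty=0$ for $0\le c<\infty$. Then the following statements are equivalent. (i) $(U,V)\in(W_{p,q}^+)^*$, that is, there is a constant $0<C<\infty$ such that for every interval $I=[a,b]$ with $-\infty<a<b<\infty$, $$\int_I\frac{U}{m_\mu^+(\omega/\chi_I)^q}\,dx\le C\Big(\int_I\omega\,dx\Big)^{q/p}.$$ (ii) The strong $(p,q)$ inequality holds for $m_\mu^+$, that is, there is a constant $0<C<\infty$ such that for every measurable $f:\mathbb{R}\to[-\infty,\infty]$,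 $$\int_{\mathbb{R}}\frac{U}{m_\mu^+(f)^q}\,dx\le C\Big(\int_{\mathbb{R}}\frac{V}{|f|^p}\,dx\Big)^{q/p}.$$ -/

import Mathlib

open MeasureTheory
open scoped ENNReal

noncomputable section

/-- A weight on `ℝ`: a (Lebesgue measurable) non-negative function, positive almost everywhere.
No local integrability is required. -/
structure IsWeight (w : ℝ → ℝ) : Prop where
  aemeasurable : AEMeasurable w volume
  nonneg : ∀ x, 0 ≤ w x
  pos_ae : ∀ᵐ x ∂(volume : Measure ℝ), 0 < w x

/-- The fractional one-sided minimal function of order `μ` of an extended real valued `f`: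
`inf_{h > 0} h^{-(1+μ)} ∫_x^{x+h} |f|`. -/
def minimalPlus (μ : ℝ) (f : ℝ → EReal) (x : ℝ) : ℝ≥0∞ :=
  ⨅ (h : ℝ) (_ : 0 < h),
    (∫⁻ t in Set.Ioc x (x + h), (f t).abs) / ENNReal.ofReal (h ^ (1 + μ))

/-- `ω = V^{1/(p+1)}`. -/
def omegaWeight (p : ℝ) (V : ℝ → ℝ) (x : ℝ) : ℝ := V x ^ (1 / (p + 1))

open Classical in
/-- The function `w / χ_I`: equal to `w` on `I` and to `+∞` outside `I`. -/
def divIndicator (w : ℝ → ℝ) (I : Set ℝ) (x : ℝ) : EReal :=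
  if x ∈ I then (w x : EReal) else ⊤

/-- The Sawyer-type testing condition `(W_{p,q}^+)^*` for the pair `(U, V)`; the constant is
uniform over all intervals. -/
def TestingCondition (μ p q : ℝ) (U V : ℝ → ℝ) : Prop :=
  ∃ C : ℝ, 0 < C ∧ ∀ a b : ℝ, a < b →
    ∫⁻ x in Set.Icc a b, ENNReal.ofReal (U x) /
        (minimalPlus μ (divIndicator (omegaWeight p V) (Set.Icc a b)) x) ^ q
      ≤ ENNReal.ofReal C *
        (∫⁻ x in Set.Icc a b, ENNReal.ofReal (omegaWeight p V x)) ^ (q / p)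

/-- The two weight strong `(p, q)` inequality for the minimal function; the constant is uniform
over all measurable extended real valued `f`. Here `c / 0 = ∞` for `c > 0` and `c / ∞ = 0`. -/
def StrongTypeInequality (μ p q : ℝ) (U V : ℝ → ℝ) : Prop :=
  ∃ C : ℝ, 0 < C ∧ ∀ f : ℝ → EReal, AEMeasurable f volume →
    ∫⁻ x, ENNReal.ofReal (U x) / (minimalPlus μ f x) ^ q
      ≤ ENNReal.ofReal C *
        (∫⁻ x, ENNReal.ofReal (V x) / (f x).abs ^ p) ^ (q / p)

end

/-! Write w = ω, F = |f| and φ = (w/F)^(p/2). Since V = w^(p+1) a.e., V/|f|^p = φ² w. For I = (x,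
x+h), with w(I), F(I) the integrals over I, Hölder (`lintegral_rpow_one_add_le`) gives w(I)^(1+p/2)
≤ F(I)^(p/2) ∫_I φ w. If the w-average of φ over I lies in (2^k, 2^(k+1)], then w(I)^q ≤
4^((k+1)q/p) F(I)^q, so F may be replaced by w at the cost of that factor. Such an I lies in one
component of the union O_k of the admissible intervals with average above 2^k. Testing on the
components (`exists_dominating_of_testing`) bounds their joint contribution by C w(O_k)^(q/p),
because q/p ≥ 1.

Summing over k, again with q/p ≥ 1, leaves Σ 4^(k+1) w(O_k) ≤ 64 ∫ φ² w, the L² bound for the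
uncentered maximal function of w dx (`tsum_four_zpow_mul_setLIntegral_le`). On the line this needs
no doubling, as intervals can be thinned to overlap at most twice. The exponent p/2 rather than p
puts the estimate in L², where the maximal function is bounded, instead of L¹.

Conversely, the strong inequality for f = ω/χ_I yields the testing condition on I. -/

/-! ### Hölder's inequality and sums of powers -/

/-- A consequence of Hölder's inequality: a weight is controlled by any a.e. positive and finite
function together with a negative power of it. -/
theorem lintegral_rpow_one_add_le {α : Type*} [MeasurableSpace α] {ν : Measure α} {r : ℝ}
    (hr : 0 < r) {w F : α → ℝ≥0∞} (hw : AEMeasurable w ν) (hF : AEMeasurable F ν)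
    (hF0 : ∀ᵐ t ∂ν, F t ≠ 0) (hFtop : ∀ᵐ t ∂ν, F t ≠ ∞) :
    (∫⁻ t, w t ∂ν) ^ (1 + r) ≤ (∫⁻ t, F t ∂ν) ^ r * ∫⁻ t, (w t / F t) ^ r * w t ∂ν := by
  have hr1 : 0 < 1 + r := by linarith
  have key : ∫⁻ t, w t ∂ν ≤
      (∫⁻ t, F t ∂ν) ^ (r / (1 + r)) *
        (∫⁻ t, (w t / F t) ^ r * w t ∂ν) ^ (1 / (1 + r)) := by
    refine le_trans (lintegral_mono_ae ?_) (ENNReal.lintegral_mul_norm_pow_le hF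
      (((hw.div hF).pow_const r).mul hw) (by positivity) (by positivity) (by field_simp; ring))
    filter_upwards [hF0, hFtop] with t h0 htop
    apply le_of_eq
    have e1 : (w t / F t) ^ r * w t = w t ^ (1 + r) / F t ^ r := by
      rw [ENNReal.div_rpow_of_nonneg _ _ hr.le, ENNReal.rpow_add_of_nonneg _ _ zero_le_one hr.le,
        ENNReal.rpow_one, div_eq_mul_inv, div_eq_mul_inv]
      ring
    have e2 : r / (1 + r) = r * (1 / (1 + r)) := by ring
    change w t = F t ^ (r / (1 + r)) * ((w t / F t) ^ r * w t) ^ (1 / (1 + r))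
    rw [e1, e2, ENNReal.rpow_mul, ← ENNReal.mul_rpow_of_nonneg _ _ (by positivity),
      ENNReal.mul_div_cancel, ← ENNReal.rpow_mul, mul_one_div_cancel hr1.ne',
      ENNReal.rpow_one]
    · exact (ENNReal.rpow_pos (pos_iff_ne_zero.2 h0) htop).ne'
    · exact ENNReal.rpow_ne_top_of_nonneg hr.le htop
  calc (∫⁻ t, w t ∂ν) ^ (1 + r) ≤ _ := ENNReal.rpow_le_rpow key hr1.le
    _ = _ := by
      rw [ENNReal.mul_rpow_of_nonneg _ _ hr1.le, ← ENNReal.rpow_mul, ← ENNReal.rpow_mul,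
        div_mul_cancel₀ _ hr1.ne', one_div_mul_cancel hr1.ne', ENNReal.rpow_one]

/-- For exponents at least one, sums of powers are dominated by the power of the sum. -/
theorem ENNReal.tsum_rpow_le_rpow_tsum {ι : Type*} (a : ι → ℝ≥0∞) {s : ℝ} (hs : 1 ≤ s) :
    ∑' i, a i ^ s ≤ (∑' i, a i) ^ s := by
  classical
  rw [ENNReal.tsum_eq_iSup_sum]
  refine iSup_le fun T => le_trans ?_
    (ENNReal.rpow_le_rpow (ENNReal.sum_le_tsum T) (zero_le_one.trans hs))
  induction T using Finset.induction_on with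
  | empty => simp
  | insert i T hi ih =>
    rw [Finset.sum_insert hi, Finset.sum_insert hi]
    exact (add_le_add le_rfl ih).trans (ENNReal.add_rpow_le_rpow_add _ _ hs)

/-- The sum of all powers of two below `2 * y` is at most `4 * y`. -/
theorem ENNReal.tsum_two_zpow_lt_le (y : ℝ≥0∞) :
    ∑' k : ℤ, (if (2 : ℝ≥0∞) ^ (k - 1) < y then (2 : ℝ≥0∞) ^ k else 0) ≤ 4 * y := by
  rcases eq_or_ne y 0 with rfl | h0
  · simp
  rcases eq_or_ne y ∞ with rfl | htop
  · simp
  -- With 2^n < y ≤ 2^(n+1), only k ≤ n + 1 contribute, and these powers sum to 4 * 2^n.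
  obtain ⟨n, hn1, hn2⟩ := ENNReal.exists_mem_Ioc_zpow h0 htop one_lt_two (by simp)
  have hinj : Function.Injective (fun j : ℕ => n + 1 - (j : ℤ)) := by
    intro i j h; simpa using h
  rw [← hinj.tsum_eq]
  · calc ∑' j : ℕ, (if (2 : ℝ≥0∞) ^ (n + 1 - (j : ℤ) - 1) < y then
          (2 : ℝ≥0∞) ^ (n + 1 - (j : ℤ)) else 0)
        ≤ ∑' j : ℕ, (2 : ℝ≥0∞) ^ (n + 1) * 2⁻¹ ^ j := by
          refine ENNReal.tsum_le_tsum fun j => ?_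
          split_ifs
          · rw [sub_eq_add_neg, ENNReal.zpow_add two_ne_zero (by simp), ENNReal.zpow_neg,
              zpow_natCast, ENNReal.inv_pow]
          · exact zero_le
      _ = 4 * 2 ^ n := by
          rw [ENNReal.tsum_mul_left, ENNReal.tsum_geometric_two,
            ENNReal.zpow_add two_ne_zero (by simp), zpow_one]
          ring
      _ ≤ 4 * y := by gcongr
  · intro k hk
    have hk' : (2 : ℝ≥0∞) ^ (k - 1) < y := by
      by_contra h; simp [h] at hk
    have : k - 1 < n + 1 := by
      by_contra h
      exact absurd (hk'.trans_le hn2) (not_lt.2 (ENNReal.zpow_le_of_le one_le_two (not_lt.1 h)))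
    exact ⟨(n + 1 - k).toNat, by simp only; omega⟩

/-! ### Covering by intervals on the line -/

/-- Every finite family of open intervals has a subfamily with the same union that covers no point
more than twice. -/
theorem exists_subfamily_card_le_two (S : Finset (ℝ × ℝ)) :
    ∃ T ⊆ S, (⋃ i ∈ S, Set.Ioo i.1 i.2) = (⋃ i ∈ T, Set.Ioo i.1 i.2) ∧
      ∀ x, (T.filter fun i => x ∈ Set.Ioo i.1 i.2).card ≤ 2 := by
  classical
  induction hn : S.card using Nat.strong_induction_on generalizing S with
  | _ n ih =>
  by_cases hS : ∀ x, (S.filter fun i => x ∈ Set.Ioo i.1 i.2).card ≤ 2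
  · exact ⟨S, subset_rfl, rfl, hS⟩
  push Not at hS
  obtain ⟨x, hx⟩ := hS
  set A := S.filter fun i => x ∈ Set.Ioo i.1 i.2
  have hne : A.Nonempty := Finset.card_pos.1 (by omega)
  obtain ⟨l, hl, hlmin⟩ := A.exists_min_image Prod.fst hne
  obtain ⟨u, hu, humax⟩ := A.exists_max_image Prod.snd hne
  -- Among three intervals through x, one is redundant: `l` reaches furthest left and `u` furthest
  -- right, so together they cover any other `m`.
  obtain ⟨m, hm, hml, hmu⟩ : ∃ m ∈ A, m ≠ l ∧ m ≠ u := by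
    by_contra! h
    have : A ⊆ {l, u} := fun m hm => by
      by_cases e : m = l
      · simp [e]
      · simp [h m hm e]
    exact absurd ((Finset.card_le_card this).trans Finset.card_le_two) (by omega)
  have hmS : m ∈ S := (Finset.mem_filter.1 hm).1
  have hcov : (⋃ i ∈ S, Set.Ioo i.1 i.2) = ⋃ i ∈ S.erase m, Set.Ioo i.1 i.2 := by
    apply Set.Subset.antisymm
    · intro y hy
      simp only [Set.mem_iUnion, exists_prop] at hy ⊢
      obtain ⟨i, hi, hyi⟩ := hy
      by_cases him : i = m
      · subst him
        have hxl := (Finset.mem_filter.1 hl)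
        have hxu := (Finset.mem_filter.1 hu)
        rcases lt_or_ge y x with hyx | hyx
        · exact ⟨l, Finset.mem_erase.2 ⟨hml.symm, hxl.1⟩,
            (hlmin i hm).trans_lt hyi.1, hyx.trans hxl.2.2⟩
        · exact ⟨u, Finset.mem_erase.2 ⟨hmu.symm, hxu.1⟩,
            hxu.2.1.trans_le hyx, hyi.2.trans_le (humax i hm)⟩
      · exact ⟨i, Finset.mem_erase.2 ⟨him, hi⟩, hyi⟩
    · exact Set.biUnion_subset_biUnion_left fun i hi => Finset.mem_of_mem_erase hi
  obtain ⟨T, hT, hTU, hT2⟩ := ih (S.erase m).card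
    (by rw [← hn]; exact Finset.card_erase_lt_of_mem hmS) (S.erase m) rfl
  exact ⟨T, hT.trans (Finset.erase_subset _ _), hcov.trans hTU, hT2⟩

/-- If `σ ≤ c τ` on each of finitely many open intervals, then `σ` of their union is at most
twice `c` times the total mass of `τ`. -/
theorem measure_biUnion_finset_Ioo_le {σ τ : Measure ℝ} {c : ℝ≥0∞} (S : Finset (ℝ × ℝ))
    (h : ∀ i ∈ S, σ (Set.Ioo i.1 i.2) ≤ c * τ (Set.Ioo i.1 i.2)) :
    σ (⋃ i ∈ S, Set.Ioo i.1 i.2) ≤ c * (2 * τ Set.univ) := by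
  classical
  obtain ⟨T, hT, hTU, hT2⟩ := exists_subfamily_card_le_two S
  rw [hTU]
  calc σ (⋃ i ∈ T, Set.Ioo i.1 i.2) ≤ ∑ i ∈ T, σ (Set.Ioo i.1 i.2) :=
        measure_biUnion_finset_le _ _
    _ ≤ ∑ i ∈ T, c * τ (Set.Ioo i.1 i.2) := Finset.sum_le_sum fun i hi => h i (hT hi)
    _ = c * ∫⁻ x, ∑ i ∈ T, (Set.Ioo i.1 i.2).indicator 1 x ∂τ := by
        rw [← Finset.mul_sum, lintegral_finsetSum _ fun i _ =>
          measurable_one.indicator measurableSet_Ioo]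
        simp [lintegral_indicator_one measurableSet_Ioo]
    _ ≤ c * ∫⁻ _, 2 ∂τ := by
        gcongr with x
        have : ∑ i ∈ T, (Set.Ioo i.1 i.2).indicator (1 : ℝ → ℝ≥0∞) x =
            ((T.filter fun i => x ∈ Set.Ioo i.1 i.2).card : ℝ≥0∞) := by
          simp [Set.indicator_apply, Finset.sum_boole]
        rw [this]
        exact_mod_cast hT2 x
    _ = c * (2 * τ Set.univ) := by rw [lintegral_const]

/-- The covering estimate behind the weak type inequality for the uncentered maximal function with
respect to an arbitrary measure on the line. -/
theorem measure_biUnion_Ioo_le {σ τ : Measure ℝ} {c : ℝ≥0∞} (S : Set (ℝ × ℝ))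
    (h : ∀ i ∈ S, σ (Set.Ioo i.1 i.2) ≤ c * τ (Set.Ioo i.1 i.2)) :
    σ (⋃ i ∈ S, Set.Ioo i.1 i.2) ≤ c * (2 * τ Set.univ) := by
  classical
  -- Lindelöf gives a countable subfamily with the same union; continuity from below along its
  -- finite subfamilies finishes.
  obtain ⟨T, hTS, hTc, hTU⟩ := TopologicalSpace.isOpen_biUnion_countable S
    (fun i => Set.Ioo i.1 i.2) fun i _ => isOpen_Ioo
  have := hTc.to_subtype
  rw [← hTU, Set.biUnion_eq_iUnion, Set.iUnion_eq_iUnion_finset, Directed.measure_iUnion]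
  · refine iSup_le fun A => ?_
    have := measure_biUnion_finset_Ioo_le (σ := σ) (τ := τ) (c := c) (A.image Subtype.val)
      (by intro i hi
          obtain ⟨j, -, rfl⟩ := Finset.mem_image.1 hi
          exact h _ (hTS j.2))
    simpa using this
  · refine directed_of_isDirected_le fun A B hAB => ?_
    exact Set.biUnion_subset_biUnion_left hAB

/-! ### The minimal function of a function into [0, ∞] -/

/-- The one-sided fractional minimal function of a function with values in `[0, ∞]`. -/
noncomputable def minimalENN (μ : ℝ) (F : ℝ → ℝ≥0∞) (x : ℝ) : ℝ≥0∞ :=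
  ⨅ (h : ℝ) (_ : 0 < h), (∫⁻ t in Set.Ioc x (x + h), F t) / ENNReal.ofReal (h ^ (1 + μ))

open Classical in
/-- The function equal to `F` on `s` and to `∞` outside `s`. -/
noncomputable def extendTop (F : ℝ → ℝ≥0∞) (s : Set ℝ) (x : ℝ) : ℝ≥0∞ :=
  if x ∈ s then F x else ∞

theorem AEMeasurable.extendTop {F : ℝ → ℝ≥0∞} (hF : AEMeasurable F) {s : Set ℝ}
    (hs : MeasurableSet s) : AEMeasurable (extendTop F s) := by
  classical
  refine ⟨s.piecewise (hF.mk F) fun _ => ∞, hF.measurable_mk.piecewise hs measurable_const, ?_⟩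
  filter_upwards [hF.ae_eq_mk] with x hx
  by_cases h : x ∈ s <;> simp [_root_.extendTop, h, hx]

theorem le_extendTop (F : ℝ → ℝ≥0∞) (s : Set ℝ) (x : ℝ) : F x ≤ extendTop F s x := by
  unfold extendTop; split_ifs <;> simp

theorem extendTop_anti (F : ℝ → ℝ≥0∞) {s t : Set ℝ} (h : s ⊆ t) (x : ℝ) :
    extendTop F t x ≤ extendTop F s x := by
  unfold extendTop
  by_cases hs : x ∈ s
  · simp [hs, h hs]
  · simp [hs]

theorem minimalENN_mono (μ : ℝ) {F G : ℝ → ℝ≥0∞} (h : ∀ x, F x ≤ G x) (x : ℝ) :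
    minimalENN μ F x ≤ minimalENN μ G x :=
  iInf₂_mono fun _ _ => ENNReal.div_le_div_right (lintegral_mono h) _

theorem minimalENN_extendTop_le (μ : ℝ) (F : ℝ → ℝ≥0∞) {s : Set ℝ} {x h : ℝ} (hh : 0 < h)
    (hs : Set.Ioc x (x + h) ⊆ s) :
    minimalENN μ (extendTop F s) x ≤
      (∫⁻ t in Set.Ioc x (x + h), F t) / ENNReal.ofReal (h ^ (1 + μ)) := by
  refine (iInf₂_le h hh).trans (le_of_eq ?_)
  rw [setLIntegral_congr_fun measurableSet_Ioc fun t ht => ?_]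
  simp [extendTop, hs ht]

/-- The infimum defining the minimal function may be taken over rational lengths. -/
theorem minimalENN_eq_iInf_rat (μ : ℝ) (F : ℝ → ℝ≥0∞) (x : ℝ) :
    minimalENN μ F x = ⨅ (r : ℚ) (_ : 0 < r),
      (∫⁻ t in Set.Ioc x (x + (r : ℝ)), F t) / ENNReal.ofReal ((r : ℝ) ^ (1 + μ)) := by
  apply le_antisymm
  · exact le_iInf₂ fun r hr => iInf₂_le (r : ℝ) (by exact_mod_cast hr)
  · refine le_iInf₂ fun h hh => ?_
    have hpos : 0 < ENNReal.ofReal (h ^ (1 + μ)) := ENNReal.ofReal_pos.2 (Real.rpow_pos_of_pos hh _)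
    rw [ENNReal.le_div_iff_mul_le (Or.inl hpos.ne') (Or.inl ENNReal.ofReal_ne_top)]
    set m := ⨅ (r : ℚ) (_ : 0 < r),
      (∫⁻ t in Set.Ioc x (x + (r : ℝ)), F t) / ENNReal.ofReal ((r : ℝ) ^ (1 + μ))
    by_contra! hlt
    -- The integral grows with the length and the power is continuous, so a rational slightly below
    -- `h` would already violate the bound by `m`.
    have hcont : Filter.Tendsto (fun r : ℝ => m * ENNReal.ofReal (r ^ (1 + μ)))
        (nhdsWithin h (Set.Iio h)) (nhds (m * ENNReal.ofReal (h ^ (1 + μ)))) := by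
      refine ENNReal.Tendsto.const_mul ?_ (Or.inl hpos.ne')
      refine ((ENNReal.continuous_ofReal.tendsto _).comp ?_).mono_left nhdsWithin_le_nhds
      exact (Real.continuousAt_rpow_const h (1 + μ) (Or.inl hh.ne')).tendsto
    obtain ⟨l, hl, hsub⟩ := (mem_nhdsLT_iff_exists_Ioo_subset).1 (hcont.eventually_const_lt hlt)
    obtain ⟨r, hr1, hr2⟩ := exists_rat_btwn (max_lt (Set.mem_Iio.1 hl) hh)
    have hr0 : (0 : ℝ) < r := (le_max_right _ _).trans_lt hr1
    have h1 := hsub ⟨(le_max_left _ _).trans_lt hr1, hr2⟩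
    have h2 : m ≤ _ := iInf₂_le r (by exact_mod_cast hr0)
    have h3 := (ENNReal.mul_le_of_le_div h2).trans (lintegral_mono_set
      (Set.Ioc_subset_Ioc_right (by linarith : x + (r : ℝ) ≤ x + h)))
    exact absurd (h1.trans_le h3) (lt_irrefl _)

/-- A countable infimum over rational lengths of integrals that depend measurably on x, by Tonelli
on the strip x < t ≤ x + r. -/
theorem measurable_minimalENN (μ : ℝ) {F : ℝ → ℝ≥0∞} (hF : AEMeasurable F) :
    Measurable (minimalENN μ F) := by
  have : minimalENN μ F = fun x => ⨅ (r : ℚ) (_ : 0 < r),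
      (∫⁻ t in Set.Ioc x (x + (r : ℝ)), F t) / ENNReal.ofReal ((r : ℝ) ^ (1 + μ)) :=
    funext (minimalENN_eq_iInf_rat μ F)
  rw [this]
  refine Measurable.iInf fun r => Measurable.iInf fun _ => Measurable.div_const ?_ _
  have e : ∀ x : ℝ, ∫⁻ t in Set.Ioc x (x + (r : ℝ)), F t =
      ∫⁻ t, {z : ℝ × ℝ | z.1 < z.2 ∧ z.2 ≤ z.1 + r}.indicator (fun z => hF.mk F z.2) (x, t) := by
    intro x
    rw [lintegral_congr_ae (ae_restrict_of_ae hF.ae_eq_mk), ← lintegral_indicator measurableSet_Ioc]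
    rfl
  simp_rw [e]
  refine Measurable.lintegral_prod_right' ((hF.measurable_mk.comp measurable_snd).indicator ?_)
  exact (measurableSet_lt measurable_fst measurable_snd).inter
    (measurableSet_le measurable_snd (measurable_fst.add_const _))

/-! ### Testing on the components of an open set -/

/-- The testing condition on intervals produces, for every bounded open set `O`, a single function
with controlled integral dominating the contribution of all intervals inside `O`. -/
theorem exists_dominating_of_testing {μ p q : ℝ} (hp : 0 < p) (hpq : p ≤ q) {U w : ℝ → ℝ≥0∞}
    (hU : AEMeasurable U) (hw : AEMeasurable w) {C : ℝ≥0∞}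
    (htest : ∀ a b : ℝ, a < b →
      ∫⁻ x in Set.Icc a b, U x / minimalENN μ (extendTop w (Set.Icc a b)) x ^ q ≤
        C * (∫⁻ x in Set.Icc a b, w x) ^ (q / p))
    {O : Set ℝ} (hO : IsOpen O) (hOb : Bornology.IsBounded O) :
    ∃ G : ℝ → ℝ≥0∞, AEMeasurable G ∧ ∫⁻ x, G x ≤ C * (∫⁻ x in O, w x) ^ (q / p) ∧
      ∀ x h, 0 < h → Set.Ioo x (x + h) ⊆ O →
        U x / ((∫⁻ t in Set.Ioc x (x + h), w t) / ENNReal.ofReal (h ^ (1 + μ))) ^ q ≤ G x := by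
  have hq : 0 < q := hp.trans_le hpq
  set 𝒞 : Set (Set ℝ) := (connectedComponentIn O) '' O
  have hopen : ∀ J ∈ 𝒞, IsOpen J := by
    rintro _ ⟨x, -, rfl⟩; exact hO.connectedComponentIn
  have hsub : ∀ J ∈ 𝒞, J ⊆ O := by
    rintro _ ⟨x, -, rfl⟩; exact connectedComponentIn_subset O x
  have hconn : ∀ J ∈ 𝒞, IsConnected J := by
    rintro _ ⟨x, hx, rfl⟩; exact isConnected_connectedComponentIn_iff.2 hx
  have hbb : ∀ J ∈ 𝒞, BddBelow J := fun J hJ => (hOb.subset (hsub J hJ)).bddBelow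
  have hba : ∀ J ∈ 𝒞, BddAbove J := fun J hJ => (hOb.subset (hsub J hJ)).bddAbove
  have hdisj : 𝒞.PairwiseDisjoint id := by
    rintro _ ⟨x, hx, rfl⟩ _ ⟨y, hy, rfl⟩ hne
    refine Set.disjoint_left.2 fun z hzx hzy => hne ?_
    exact (connectedComponentIn_eq hzx).trans (connectedComponentIn_eq hzy).symm
  have hcount : 𝒞.Countable :=
    hdisj.countable_of_isOpen hopen fun J hJ => (hconn J hJ).nonempty
  have := hcount.to_subtype
  have hunion : (⋃ J ∈ 𝒞, J) = O := by
    apply Set.Subset.antisymm (Set.iUnion₂_subset hsub)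
    intro x hx
    exact Set.mem_biUnion (Set.mem_image_of_mem _ hx) (mem_connectedComponentIn hx)
  -- The closed hull adds only endpoints to the component. It is needed because the left endpoint x
  -- of an interval inside `O` may itself lie outside `O`.
  let Q : Set ℝ → Set ℝ := fun J => Set.Icc (sInf J) (sSup J)
  have hJQ : ∀ J ∈ 𝒞, J ⊆ Q J := fun J hJ => subset_Icc_csInf_csSup (hbb J hJ) (hba J hJ)
  have hmeas : ∀ J : Set ℝ, AEMeasurable
      ((Q J).indicator fun x => U x / minimalENN μ (extendTop w (Q J)) x ^ q) := fun J =>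
    (hU.div ((measurable_minimalENN μ (hw.extendTop measurableSet_Icc)).pow_const
      q).aemeasurable).indicator measurableSet_Icc
  refine ⟨fun x => ∑' J : 𝒞,
    (Q J).indicator (fun x => U x / minimalENN μ (extendTop w (Q J)) x ^ q) x, ?_, ?_, ?_⟩
  · exact AEMeasurable.tsum fun J : 𝒞 => hmeas J
  · rw [lintegral_tsum fun J : 𝒞 => hmeas J]
    calc ∑' J : 𝒞, ∫⁻ x, (Q J).indicator
            (fun x => U x / minimalENN μ (extendTop w (Q J)) x ^ q) x
        ≤ ∑' J : 𝒞, C * (∫⁻ x in (J : Set ℝ), w x) ^ (q / p) := by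
          refine ENNReal.tsum_le_tsum fun ⟨J, hJ⟩ => ?_
          have hlt : sInf J < sSup J := by
            obtain ⟨x, hx⟩ := (hconn J hJ).nonempty
            obtain ⟨y, hy, hyx⟩ := (Filter.Eventually.and
              (nhdsWithin_le_nhds ((hopen J hJ).mem_nhds hx))
              (self_mem_nhdsWithin : Set.Ioi x ∈ nhdsWithin x (Set.Ioi x))).exists
            exact (csInf_le (hbb J hJ) hx).trans_lt
              ((Set.mem_Ioi.1 hyx).trans_le (le_csSup (hba J hJ) hy))
          rw [lintegral_indicator measurableSet_Icc]
          refine (htest _ _ hlt).trans ?_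
          gcongr C * ?_ ^ (q / p)
          rw [← setLIntegral_congr Ioo_ae_eq_Icc]
          exact lintegral_mono_set ((hconn J hJ).Ioo_csInf_csSup_subset (hbb J hJ) (hba J hJ))
      _ ≤ C * (∑' J : 𝒞, ∫⁻ x in (J : Set ℝ), w x) ^ (q / p) := by
          rw [ENNReal.tsum_mul_left]
          gcongr
          exact ENNReal.tsum_rpow_le_rpow_tsum _ ((one_le_div hp).2 hpq)
      _ = C * (∫⁻ x in O, w x) ^ (q / p) := by
          rw [← lintegral_biUnion hcount (fun J hJ => (hopen J hJ).measurableSet) hdisj]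
          simp only [hunion]
  · intro x h hh hxO
    have hmid : x + h / 2 ∈ Set.Ioo x (x + h) := ⟨by linarith, by linarith⟩
    let J := connectedComponentIn O (x + h / 2)
    have hJ : J ∈ 𝒞 := Set.mem_image_of_mem _ (hxO hmid)
    have hIJ : Set.Ioo x (x + h) ⊆ J := isPreconnected_Ioo.subset_connectedComponentIn hmid hxO
    have hcl : Set.Icc x (x + h) ⊆ Q J := by
      rw [← closure_Ioo (by linarith : x ≠ x + h)]
      exact closure_minimal (hIJ.trans (hJQ J hJ)) isClosed_Icc
    refine le_trans ?_ (ENNReal.le_tsum (⟨J, hJ⟩ : 𝒞))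
    rw [Set.indicator_of_mem (hcl ⟨le_rfl, by linarith⟩)]
    gcongr
    exact minimalENN_extendTop_le μ w hh (Set.Ioc_subset_Icc_self.trans hcl)

/-! ### The dyadic L² maximal estimate -/

theorem ENNReal.four_zpow (k : ℤ) : (4 : ℝ≥0∞) ^ k = 2 ^ k * 2 ^ k := by
  have h4 : (4 : ℝ≥0∞) = ((2 * 2 : NNReal) : ℝ≥0∞) := by norm_num
  have h2 : (2 : ℝ≥0∞) = ((2 : NNReal) : ℝ≥0∞) := rfl
  rw [h4, h2, ← ENNReal.coe_zpow (by norm_num), ← ENNReal.coe_zpow (by norm_num), mul_zpow,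
    ENNReal.coe_mul]

/-- The dyadic form of the `L²` bound for the uncentered maximal function with respect to the
measure `w dx`: each `S k` is a family of intervals on which the `w`-average of `φ` exceeds
`2 ^ k`. -/
theorem tsum_four_zpow_mul_setLIntegral_le {w φ : ℝ → ℝ≥0∞} (hw : AEMeasurable w)
    (hφ : AEMeasurable φ) (S : ℤ → Set (ℝ × ℝ))
    (hSfin : ∀ k, ∀ i ∈ S k, ∫⁻ t in Set.Ioo i.1 i.2, w t ≠ ∞)
    (hS : ∀ k, ∀ i ∈ S k,
      2 ^ k * ∫⁻ t in Set.Ioo i.1 i.2, w t < ∫⁻ t in Set.Ioo i.1 i.2, φ t * w t) :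
    ∑' k, 4 ^ (k + 1) * ∫⁻ t in ⋃ i ∈ S k, Set.Ioo i.1 i.2, w t ≤
      64 * ∫⁻ t, φ t * φ t * w t := by
  -- The part of φ below 2^(k-1) accounts for at most half of an average exceeding 2^k, so the
  -- truncation `ψ k` still has average at least 2^(k-1).
  let ψ : ℤ → ℝ → ℝ≥0∞ := fun k => {t | (2 : ℝ≥0∞) ^ (k - 1) < φ t}.indicator fun t => φ t * w t
  have hψ : ∀ k, AEMeasurable (ψ k) := fun k =>
    (hφ.mul hw).indicator₀ (nullMeasurableSet_lt aemeasurable_const hφ)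
  have hz : ∀ k : ℤ, (2 : ℝ≥0∞) ^ k ≠ 0 := fun k => (ENNReal.zpow_pos two_ne_zero (by simp) k).ne'
  have hzt : ∀ k : ℤ, (2 : ℝ≥0∞) ^ k ≠ ∞ := fun k => ENNReal.zpow_ne_top two_ne_zero (by simp) k
  have hsucc : ∀ k : ℤ, (2 : ℝ≥0∞) ^ k = 2 * 2 ^ (k - 1) := fun k => by
    conv_lhs => rw [← sub_add_cancel k 1]
    rw [ENNReal.zpow_add two_ne_zero (by simp), zpow_one, mul_comm]
  have hlevel : ∀ k, ∫⁻ t in ⋃ i ∈ S k, Set.Ioo i.1 i.2, w t ≤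
      (2 ^ (k - 1))⁻¹ * (2 * ∫⁻ t, ψ k t) := by
    intro k
    have hO : IsOpen (⋃ i ∈ S k, Set.Ioo i.1 i.2) := isOpen_biUnion fun i _ => isOpen_Ioo
    have key := measure_biUnion_Ioo_le (σ := volume.withDensity w) (τ := volume.withDensity (ψ k))
      (c := ((2 : ℝ≥0∞) ^ (k - 1))⁻¹) (S k) ?_
    · rwa [withDensity_apply _ hO.measurableSet, withDensity_apply _ MeasurableSet.univ,
        setLIntegral_univ] at key
    · intro i hi
      rw [withDensity_apply _ measurableSet_Ioo, withDensity_apply _ measurableSet_Ioo,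
        mul_comm, ← div_eq_mul_inv, ENNReal.le_div_iff_mul_le (Or.inl (hz _)) (Or.inl (hzt _))]
      have h1 : ∫⁻ t in Set.Ioo i.1 i.2, φ t * w t ≤
          ∫⁻ t in Set.Ioo i.1 i.2, ψ k t + 2 ^ (k - 1) * w t := by
        refine lintegral_mono fun t => ?_
        by_cases ht : (2 : ℝ≥0∞) ^ (k - 1) < φ t
        · simp [ψ, ht]
        · refine le_add_left ?_
          gcongr
          exact not_lt.1 ht
      rw [lintegral_add_right' _ (hw.restrict.const_mul _), lintegral_const_mul' _ _ (hzt _)] at h1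
      have h2 := (hS k i hi).le.trans h1
      rw [hsucc k, two_mul, add_mul] at h2
      rw [mul_comm]
      exact (ENNReal.add_le_add_iff_right (ENNReal.mul_ne_top (hzt _) (hSfin k i hi))).1 h2
  have hfour : ∀ k : ℤ, (4 : ℝ≥0∞) ^ (k + 1) * ((2 ^ (k - 1))⁻¹ * 2) = 16 * 2 ^ k := by
    intro k
    have e2 : (2 : ℝ≥0∞) ^ (k + 1) = 4 * 2 ^ (k - 1) := by
      rw [hsucc (k + 1), add_sub_cancel_right, hsucc k, ← mul_assoc]; norm_num
    calc (4 : ℝ≥0∞) ^ (k + 1) * ((2 ^ (k - 1))⁻¹ * 2)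
        = (4 * 2 * 2 ^ (k + 1)) * (2 ^ (k - 1) * (2 ^ (k - 1))⁻¹) := by
          rw [ENNReal.four_zpow]; nth_rw 1 [e2]; ring
      _ = 16 * 2 ^ k := by
          rw [ENNReal.mul_inv_cancel (hz _) (hzt _), mul_one, hsucc (k + 1), add_sub_cancel_right,
            ← mul_assoc]
          norm_num
  calc ∑' k, 4 ^ (k + 1) * ∫⁻ t in ⋃ i ∈ S k, Set.Ioo i.1 i.2, w t
      ≤ ∑' k : ℤ, 16 * 2 ^ k * ∫⁻ t, ψ k t := by
        refine ENNReal.tsum_le_tsum fun k => ?_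
        rw [← hfour k, mul_assoc, mul_assoc]
        gcongr
        exact hlevel k
    _ = ∫⁻ t, ∑' k : ℤ, 16 * 2 ^ k * ψ k t := by
        rw [lintegral_tsum fun k => (hψ k).const_mul _]
        exact tsum_congr fun k =>
          (lintegral_const_mul' _ _ (ENNReal.mul_ne_top (by simp) (hzt k))).symm
    _ ≤ ∫⁻ t, 64 * (φ t * φ t * w t) := by
        refine lintegral_mono fun t => ?_
        calc ∑' k : ℤ, 16 * 2 ^ k * ψ k t
            = ∑' k : ℤ, (if (2 : ℝ≥0∞) ^ (k - 1) < φ t then (2 : ℝ≥0∞) ^ k else 0) *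
                (16 * (φ t * w t)) := by
              refine tsum_congr fun k => ?_
              by_cases ht : (2 : ℝ≥0∞) ^ (k - 1) < φ t
              · simp only [ψ, Set.indicator_apply, Set.mem_ofPred_eq, ht, if_true]; ring
              · simp [ψ, ht]
          _ ≤ 4 * φ t * (16 * (φ t * w t)) := by
              rw [ENNReal.tsum_mul_right]
              gcongr
              exact ENNReal.tsum_two_zpow_lt_le _
          _ = 64 * (φ t * φ t * w t) := by ring
    _ = 64 * ∫⁻ t, φ t * φ t * w t := lintegral_const_mul' _ _ (by simp)

/-- Taking powers preserves order and inversion reverses it. Bounds on U/m^q can thus be checked one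
length h at a time. -/
theorem ENNReal.div_iInf_rpow {ι : Sort*} (u : ℝ≥0∞) (m : ι → ℝ≥0∞) {q : ℝ} (hq : 0 < q) :
    u / (⨅ i, m i) ^ q = ⨆ i, u / m i ^ q := by
  have : (⨅ i, m i) ^ q = ⨅ i, m i ^ q := (ENNReal.orderIsoRpow q hq).map_iInf m
  simp only [this, div_eq_mul_inv, ENNReal.inv_iInf, ENNReal.mul_iSup]

/-! ### From testing to the strong type inequality -/

/-- The strong type inequality for functions that are infinite outside a bounded interval. -/
theorem strong_type_of_testing_of_eq_top {μ p q : ℝ} (hp : 0 < p) (hpq : p ≤ q)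
    {U w F : ℝ → ℝ≥0∞} (hU : AEMeasurable U) (hw : AEMeasurable w) (hF : AEMeasurable F)
    (hw0 : ∀ᵐ t, w t ≠ 0) {C : ℝ≥0∞} (hC : C ≠ 0)
    (htest : ∀ a b : ℝ, a < b →
      ∫⁻ x in Set.Icc a b, U x / minimalENN μ (extendTop w (Set.Icc a b)) x ^ q ≤
        C * (∫⁻ x in Set.Icc a b, w x) ^ (q / p))
    {R : ℝ} (hR : ∀ x ∉ Set.Icc (-R) R, F x = ∞) :
    ∫⁻ x, U x / minimalENN μ F x ^ q ≤
      C * (64 * ∫⁻ t, (w t / F t) ^ p * w t) ^ (q / p) := by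
  have hq : 0 < q := hp.trans_le hpq
  have hqp : 0 < q / p := div_pos hq hp
  rcases eq_or_ne (∫⁻ t, (w t / F t) ^ p * w t) ∞ with hN | hN
  · rw [hN, ENNReal.mul_top (by norm_num), ENNReal.top_rpow_of_pos hqp, ENNReal.mul_top hC]
    exact le_top
  have hr : 0 < p / 2 := by positivity
  set φ : ℝ → ℝ≥0∞ := fun t => (w t / F t) ^ (p / 2) with hφdef
  have hφ : AEMeasurable φ := (hw.div hF).pow_const _
  have hφφ : ∀ t, φ t * φ t = (w t / F t) ^ p := fun t => by
    rw [hφdef, ← ENNReal.rpow_add_of_nonneg _ _ hr.le hr.le, add_halves]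
  have hF0 : ∀ᵐ t, F t ≠ 0 := by
    filter_upwards [hw0, ae_lt_top' (((hw.div hF).pow_const p).mul hw) hN] with t ht hlt h0
    refine hlt.ne ?_
    change (w t / F t) ^ p * w t = ∞
    rw [h0, ENNReal.div_zero ht, ENNReal.top_rpow_of_pos hp, ENNReal.top_mul ht]
  set S : ℤ → Set (ℝ × ℝ) := fun k => {i | Set.Ioo i.1 i.2 ⊆ Set.Icc (-R) R ∧
    ∫⁻ t in Set.Ioo i.1 i.2, w t ≠ ∞ ∧
    2 ^ k * ∫⁻ t in Set.Ioo i.1 i.2, w t < ∫⁻ t in Set.Ioo i.1 i.2, φ t * w t}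
  have hmax := tsum_four_zpow_mul_setLIntegral_le hw hφ S (fun k i hi => hi.2.1)
    (fun k i hi => hi.2.2)
  simp_rw [hφφ] at hmax
  choose G hGm hGint hG using fun k => exists_dominating_of_testing hp hpq hU hw htest
    (O := ⋃ i ∈ S k, Set.Ioo i.1 i.2) (isOpen_biUnion fun i _ => isOpen_Ioo)
    ((Metric.isBounded_Icc (-R) R).subset (Set.iUnion₂_subset fun i hi => hi.1))
  let c : ℤ → ℝ≥0∞ := fun k => (4 ^ (k + 1)) ^ (q / p)
  have hc0 : ∀ k, c k ≠ 0 := fun k => (ENNReal.rpow_pos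
    (ENNReal.zpow_pos (by norm_num) (by simp) _) (ENNReal.zpow_ne_top (by norm_num) (by simp) _)).ne'
  have hct : ∀ k, c k ≠ ∞ := fun k => ENNReal.rpow_ne_top_of_nonneg hqp.le
    (ENNReal.zpow_ne_top (by norm_num) (by simp) _)
  have hpt : ∀ x, U x / minimalENN μ F x ^ q ≤ ∑' k, c k * G k x := by
    intro x
    simp only [minimalENN, ENNReal.div_iInf_rpow _ _ hq]
    refine iSup₂_le fun h hh => ?_
    set H := ENNReal.ofReal (h ^ (1 + μ)) with hH
    rw [← setLIntegral_congr (Ioo_ae_eq_Ioc (a := x) (b := x + h))]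
    rcases eq_or_ne (∫⁻ t in Set.Ioo x (x + h), F t) ∞ with hinf | hfin
    · rw [hinf, ENNReal.top_div_of_ne_top ENNReal.ofReal_ne_top, ENNReal.top_rpow_of_pos hq,
        ENNReal.div_top]
      exact zero_le
    have hFt := ae_lt_top' hF.restrict hfin
    -- F is finite a.e. on the interval, so the open part outside [-R, R] is null, hence empty.
    have hsub : Set.Ioo x (x + h) ⊆ Set.Icc (-R) R := by
      have hopen : IsOpen (Set.Ioo x (x + h) \ Set.Icc (-R) R) := isOpen_Ioo.sdiff isClosed_Icc
      rw [← Set.sdiff_eq_empty, ← hopen.measure_eq_zero_iff volume]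
      refine measure_mono_null (fun y hy => ?_)
        (mem_ae_iff.1 ((ae_restrict_iff' measurableSet_Ioo).1 hFt))
      simp only [Set.mem_compl_iff, Set.mem_ofPred_eq, not_forall]
      exact ⟨hy.1, by simp [hR y hy.2]⟩
    have hholder : ∀ r : ℝ, 0 < r → (∫⁻ t in Set.Ioo x (x + h), w t) ^ (1 + r) ≤
        (∫⁻ t in Set.Ioo x (x + h), F t) ^ r *
          ∫⁻ t in Set.Ioo x (x + h), (w t / F t) ^ r * w t := fun r hr =>
      lintegral_rpow_one_add_le hr hw.restrict hF.restrict (ae_restrict_of_ae hF0)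
        (hFt.mono fun t ht => ht.ne)
    set s := ∫⁻ t in Set.Ioo x (x + h), w t with hs
    -- Local integrability of w is not assumed; Hölder with r = p supplies it here, from finite ∫ F
    -- and finite right-hand side.
    have hsfin : s ≠ ∞ := by
      intro htop
      have h1 := hholder p hp
      rw [htop, ENNReal.top_rpow_of_pos (by linarith), top_le_iff] at h1
      exact ENNReal.mul_ne_top (ENNReal.rpow_ne_top_of_nonneg hp.le hfin)
        (ne_top_of_le_ne_top hN (setLIntegral_le_lintegral _ _)) h1
    have hs0 : s ≠ 0 := by
      intro h0
      rw [hs, lintegral_eq_zero_iff' hw.restrict] at h0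
      have h1 : ∀ᵐ _ ∂(volume.restrict (Set.Ioo x (x + h))), False := by
        filter_upwards [h0, ae_restrict_of_ae hw0] with t h1 h2
        exact h2 h1
      rw [Filter.eventually_false_iff_eq_bot, ae_eq_bot, Measure.restrict_eq_zero,
        Real.volume_Ioo, ENNReal.ofReal_eq_zero] at h1
      linarith
    have hmain := hholder (p / 2) hr
    change s ^ (1 + p / 2) ≤ _ * ∫⁻ t in Set.Ioo x (x + h), φ t * w t at hmain
    set a := ∫⁻ t in Set.Ioo x (x + h), φ t * w t
    have ha0 : a ≠ 0 := by
      intro h0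
      rw [h0, mul_zero, nonpos_iff_eq_zero, ENNReal.rpow_eq_zero_iff_of_pos (by linarith)] at hmain
      exact hs0 hmain
    have hat : a ≠ ∞ := by
      -- φ ≤ 1 + φ².
      have h1 : a ≤ ∫⁻ t in Set.Ioo x (x + h), (w t + (w t / F t) ^ p * w t) := by
        refine lintegral_mono fun t => ?_
        change φ t * w t ≤ w t + (w t / F t) ^ p * w t
        rw [← hφφ]
        rcases le_total (φ t) 1 with hle | hle
        · exact le_add_right (mul_le_of_le_one_left' hle)
        · refine le_add_left ?_
          gcongr
          exact le_mul_of_one_le_left' hle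
      rw [lintegral_add_left' hw.restrict] at h1
      exact ne_top_of_le_ne_top (ENNReal.add_ne_top.2 ⟨hsfin,
        ne_top_of_le_ne_top hN (setLIntegral_le_lintegral _ _)⟩) h1
    obtain ⟨k, hk1, hk2⟩ := ENNReal.exists_mem_Ioc_zpow (x := a / s)
      (ENNReal.div_ne_zero.2 ⟨ha0, hsfin⟩) (ENNReal.div_ne_top hat hs0) ENNReal.one_lt_two (by simp)
    rw [ENNReal.lt_div_iff_mul_lt (Or.inl hs0) (Or.inl hsfin)] at hk1
    rw [ENNReal.div_le_iff hs0 hsfin] at hk2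
    have hIS : Set.Ioo x (x + h) ⊆ ⋃ i ∈ S k, Set.Ioo i.1 i.2 :=
      Set.subset_biUnion_of_mem (u := fun i : ℝ × ℝ => Set.Ioo i.1 i.2)
        (show (x, x + h) ∈ S k from ⟨hsub, hsfin, hk1⟩)
    have hdom := hG k x h hh hIS
    rw [← setLIntegral_congr (Ioo_ae_eq_Ioc (a := x) (b := x + h)), ← hs, ← hH] at hdom
    set b := ∫⁻ t in Set.Ioo x (x + h), F t
    have hsr : s ^ (p / 2) ≤ b ^ (p / 2) * 2 ^ (k + 1) := by
      have h1 : s ^ (p / 2) * s ≤ b ^ (p / 2) * 2 ^ (k + 1) * s := by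
        calc s ^ (p / 2) * s = s ^ (1 + p / 2) := by
              rw [ENNReal.rpow_add_of_nonneg _ _ zero_le_one hr.le, ENNReal.rpow_one, mul_comm]
          _ ≤ b ^ (p / 2) * a := hmain
          _ ≤ _ := by rw [mul_assoc]; gcongr
      exact (ENNReal.mul_le_mul_iff_left hs0 hsfin).1 h1
    -- Raising to the power 2q/p turns p/2 into q and 2^(k+1) into `c k`.
    have hsq : s ^ q ≤ c k * b ^ q := by
      have h1 := ENNReal.rpow_le_rpow hsr (z := 2 * (q / p)) (by positivity)
      have e : p / 2 * (2 * (q / p)) = q := by field_simp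
      have e4 : ((2 : ℝ≥0∞) ^ (k + 1)) ^ (2 * (q / p)) = c k := by
        rw [ENNReal.rpow_mul, ENNReal.rpow_two, pow_two, ← ENNReal.four_zpow]
      rwa [ENNReal.mul_rpow_of_nonneg _ _ (by positivity), ← ENNReal.rpow_mul, ← ENNReal.rpow_mul,
        e, e4, mul_comm] at h1
    calc U x / (b / H) ^ q = c k * U x / (c k * (b / H) ^ q) :=
          (ENNReal.mul_div_mul_left _ _ (hc0 k) (hct k)).symm
      _ ≤ c k * U x / (s / H) ^ q := by
          refine ENNReal.div_le_div_left ?_ _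
          rw [ENNReal.div_rpow_of_nonneg _ _ hq.le, ENNReal.div_rpow_of_nonneg _ _ hq.le,
            ← mul_div_assoc]
          exact ENNReal.div_le_div_right hsq _
      _ = c k * (U x / (s / H) ^ q) := mul_div_assoc _ _ _
      _ ≤ c k * G k x := by gcongr
      _ ≤ _ := ENNReal.le_tsum (f := fun k => c k * G k x) k
  calc ∫⁻ x, U x / minimalENN μ F x ^ q ≤ ∫⁻ x, ∑' k, c k * G k x := lintegral_mono hpt
    _ = ∑' k, c k * ∫⁻ x, G k x := by
        rw [lintegral_tsum fun k => (hGm k).const_mul _]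
        exact tsum_congr fun k => lintegral_const_mul' _ _ (hct k)
    _ ≤ ∑' k, C * (4 ^ (k + 1) * ∫⁻ t in ⋃ i ∈ S k, Set.Ioo i.1 i.2, w t) ^ (q / p) := by
        refine ENNReal.tsum_le_tsum fun k => ?_
        rw [ENNReal.mul_rpow_of_nonneg _ _ hqp.le, mul_left_comm]
        gcongr
        exact hGint k
    _ ≤ C * (∑' k, 4 ^ (k + 1) * ∫⁻ t in ⋃ i ∈ S k, Set.Ioo i.1 i.2, w t) ^ (q / p) := by
        rw [ENNReal.tsum_mul_left]
        gcongr
        exact ENNReal.tsum_rpow_le_rpow_tsum _ ((one_le_div hp).2 hpq)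
    _ ≤ _ := by gcongr

/-- The testing condition on intervals implies the strong type inequality. -/
theorem strong_type_of_testing {μ p q : ℝ} (hp : 0 < p) (hpq : p ≤ q)
    {U w F : ℝ → ℝ≥0∞} (hU : AEMeasurable U) (hw : AEMeasurable w) (hF : AEMeasurable F)
    (hw0 : ∀ᵐ t, w t ≠ 0) {C : ℝ≥0∞} (hC : C ≠ 0)
    (htest : ∀ a b : ℝ, a < b →
      ∫⁻ x in Set.Icc a b, U x / minimalENN μ (extendTop w (Set.Icc a b)) x ^ q ≤
        C * (∫⁻ x in Set.Icc a b, w x) ^ (q / p)) :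
    ∫⁻ x, U x / minimalENN μ F x ^ q ≤
      C * (64 * ∫⁻ t, (w t / F t) ^ p * w t) ^ (q / p) := by
  have hq : 0 < q := hp.trans_le hpq
  let F' : ℕ → ℝ → ℝ≥0∞ := fun n => extendTop F (Set.Icc (-(n : ℝ)) n)
  have hF' : ∀ n, AEMeasurable (F' n) := fun n => hF.extendTop measurableSet_Icc
  have hle : ∀ x, minimalENN μ F x = ⨅ n, minimalENN μ (F' n) x := by
    intro x
    apply le_antisymm (le_iInf fun n => minimalENN_mono μ (le_extendTop F _) x)
    refine le_iInf₂ fun h hh => ?_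
    -- Once [-n, n] contains (x, x+h], truncation leaves this quotient unchanged; monotone
    -- convergence then removes the truncation.
    obtain ⟨n, hn⟩ := exists_nat_ge (max (-x) (x + h))
    refine (iInf_le _ n).trans (minimalENN_extendTop_le μ F hh fun y hy => ?_)
    have h1 := (le_max_left _ _).trans hn
    have h2 := (le_max_right _ _).trans hn
    exact ⟨by linarith [hy.1], hy.2.trans h2⟩
  simp_rw [hle, ENNReal.div_iInf_rpow _ _ hq]
  have hm : ∀ n, AEMeasurable fun x => U x / minimalENN μ (F' n) x ^ q := fun n =>
    hU.div ((measurable_minimalENN μ (hF' n)).pow_const q).aemeasurable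
  rw [lintegral_iSup' hm]
  · refine iSup_le fun n => (strong_type_of_testing_of_eq_top hp hpq hU hw (hF' n) hw0 hC htest
      (R := n) fun x hx => by simp [F', extendTop, hx]).trans ?_
    gcongr with t
    exact le_extendTop F _ t
  · refine Filter.Eventually.of_forall fun x n m hnm => ?_
    have hnm' : (n : ℝ) ≤ m := by exact_mod_cast hnm
    refine ENNReal.div_le_div_left (ENNReal.rpow_le_rpow (minimalENN_mono μ (extendTop_anti F
      (Set.Icc_subset_Icc (neg_le_neg hnm') hnm')) x) hq.le) _

/-! ### Translation to real weights and the equivalence -/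

theorem abs_divIndicator {w : ℝ → ℝ} (hw : ∀ x, 0 ≤ w x) (s : Set ℝ) (x : ℝ) :
    (divIndicator w s x).abs = extendTop (fun t => ENNReal.ofReal (w t)) s x := by
  unfold divIndicator extendTop
  split_ifs
  · rw [EReal.abs_def, abs_of_nonneg (hw x)]
  · rfl

theorem minimalPlus_divIndicator (μ : ℝ) {w : ℝ → ℝ} (hw : ∀ x, 0 ≤ w x) (s : Set ℝ) :
    minimalPlus μ (divIndicator w s) =
      minimalENN μ (extendTop (fun t => ENNReal.ofReal (w t)) s) := by
  funext x
  simp only [minimalPlus, minimalENN, abs_divIndicator hw]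

/-- This is V = ω^(p+1) divided by y^p; both sides carry the same factor y^(-p), so y = 0 and y = ∞
are allowed. -/
theorem ofReal_div_rpow_eq {p : ℝ} (hp : 0 < p) {v : ℝ} (hv : 0 < v) (y : ℝ≥0∞) :
    ENNReal.ofReal v / y ^ p =
      (ENNReal.ofReal (v ^ (1 / (p + 1))) / y) ^ p * ENNReal.ofReal (v ^ (1 / (p + 1))) := by
  have e : ENNReal.ofReal v = ENNReal.ofReal (v ^ (1 / (p + 1))) ^ p *
      ENNReal.ofReal (v ^ (1 / (p + 1))) := by
    rw [ENNReal.ofReal_rpow_of_pos (by positivity), ← ENNReal.ofReal_mul (by positivity),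
      ← Real.rpow_mul hv.le, ← Real.rpow_add hv]
    have : 1 / (p + 1) * p + 1 / (p + 1) = 1 := by field_simp
    rw [this, Real.rpow_one]
  rw [ENNReal.div_rpow_of_nonneg _ _ hp.le]
  conv_lhs => rw [e]
  simp only [div_eq_mul_inv]
  ring

theorem IsWeight.aemeasurable_omegaWeight {V : ℝ → ℝ} (hV : IsWeight V) (p : ℝ) :
    AEMeasurable (omegaWeight p V) :=
  hV.aemeasurable.pow_const _

theorem omegaWeight_nonneg {V : ℝ → ℝ} (hV : IsWeight V) (p x : ℝ) : 0 ≤ omegaWeight p V x :=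
  Real.rpow_nonneg (hV.nonneg x) _

theorem theorem3p3 (μ p q : ℝ) (hμ : 0 ≤ μ) (hp : 0 < p) (hpq : p ≤ q)
    (U V : ℝ → ℝ) (hU : IsWeight U) (hV : IsWeight V) :
    TestingCondition μ p q U V ↔ StrongTypeInequality μ p q U V := by
  have hq : 0 < q := hp.trans_le hpq
  have hqp : 0 < q / p := div_pos hq hp
  have hω0 := omegaWeight_nonneg hV p
  have hω := hV.aemeasurable_omegaWeight p
  constructor
  · rintro ⟨C, hC, htest⟩
    refine ⟨C * 64 ^ (q / p), by positivity, fun f hf => ?_⟩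
    simp_rw [minimalPlus_divIndicator μ hω0] at htest
    have hF : AEMeasurable fun t => (f t).abs := (EReal.measurable_of_measurable_real
      (f := EReal.abs) (measurable_id.abs.ennreal_ofReal)).comp_aemeasurable hf
    have hw0 : ∀ᵐ t, ENNReal.ofReal (omegaWeight p V t) ≠ 0 := by
      filter_upwards [hV.pos_ae] with t ht
      exact (ENNReal.ofReal_pos.2 (Real.rpow_pos_of_pos ht _)).ne'
    have key := strong_type_of_testing hp hpq hU.aemeasurable.ennreal_ofReal hω.ennreal_ofReal hF
      hw0 (ENNReal.ofReal_pos.2 hC).ne' htest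
    refine key.trans (le_of_eq ?_)
    rw [ENNReal.mul_rpow_of_nonneg _ _ hqp.le, ENNReal.ofReal_mul hC.le,
      ← ENNReal.ofReal_rpow_of_pos (by norm_num), mul_assoc, ENNReal.ofReal_ofNat]
    congr 3
    refine lintegral_congr_ae ?_
    filter_upwards [hV.pos_ae] with t ht
    exact (ofReal_div_rpow_eq hp ht _).symm
  · rintro ⟨C, hC, hstrong⟩
    refine ⟨C, hC, fun a b hab => ?_⟩
    have hmeas : AEMeasurable (divIndicator (omegaWeight p V) (Set.Icc a b)) := by
      classical
      refine ⟨(Set.Icc a b).piecewise (fun t => ((hω.mk _ t : ℝ) : EReal)) fun _ => ⊤,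
        (hω.measurable_mk.coe_real_ereal).piecewise measurableSet_Icc measurable_const, ?_⟩
      filter_upwards [hω.ae_eq_mk] with x hx
      by_cases h : x ∈ Set.Icc a b
      · rw [Set.piecewise_eq_of_mem _ _ _ h, ← hx]; simp only [divIndicator, if_pos h]
      · rw [Set.piecewise_eq_of_notMem _ _ _ h]; simp only [divIndicator, if_neg h]
    -- For f = ω/χ_I, V/|f|^p is a.e. ω on I, and 0 outside because c/∞ = 0.
    refine (setLIntegral_le_lintegral _ _).trans ((hstrong _ hmeas).trans (le_of_eq ?_))
    congr 2
    rw [← lintegral_indicator measurableSet_Icc]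
    refine lintegral_congr_ae ?_
    filter_upwards [hV.pos_ae] with t ht
    have hpos : 0 < ENNReal.ofReal (omegaWeight p V t) :=
      ENNReal.ofReal_pos.2 (Real.rpow_pos_of_pos ht _)
    rw [abs_divIndicator hω0]
    by_cases h : t ∈ Set.Icc a b
    · rw [Set.indicator_of_mem h, ofReal_div_rpow_eq hp ht]
      simp only [extendTop, if_pos h]
      change (ENNReal.ofReal (omegaWeight p V t) / ENNReal.ofReal (omegaWeight p V t)) ^ p *
        ENNReal.ofReal (omegaWeight p V t) = _
      rw [ENNReal.div_self hpos.ne' ENNReal.ofReal_ne_top, ENNReal.one_rpow, one_mul]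
    · rw [Set.indicator_of_notMem h]
      simp only [extendTop, if_neg h, ENNReal.top_rpow_of_pos hp, ENNReal.div_top]
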